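/- Let $K\ge 2$ and let $\mathsf P$ be the family of all nonempty subsets of $\{1,\dots,K\}$, ordered by inclusion. The $K$-user combination network is the noiseless discrete memoryless broadcast channel with input $X=(V_S)_{S\in\mathsf P}$, where $V_S$ ranges over a finite nonempty alphabet $\mathcal V_S$ with $|\mathcal V_S|=2^{C_S}$, and with outputs $Y_k=(V_S: S\in\mathsf P,\ k\in S)$, $k=1,\dots,K$. Write $C_{\mathsf B}=\sum_{S\in\mathsf B}C_S$ for $\mathsf B\subseteq\mathsf P$, $\mathsf W_k=\{S\in\mathsf P: k\in S\}$, and $\uparrow\{T\}=\{S\in\mathsf P: T\subseteq S\}$. Let $\emptyset\ne S_p\subsetneq\{1,\dots,K\}$. Two independent messages are sent: a private message of rate $R_p\ge 0$ intended for the receivers in $S_p$, and a common message of rate $R_c\ge 0$ intended for all $K$ receivers. A rate pair is called achievable if there are block codes of lengths $n=1,2,\dots$ with $\lfloor 2^{nR_p}\rfloor$ private and $\lfloor 2^{nR_c}\rfloor$ common messages for which the probability that not all receivers correctly decode their intended messages (messages being uniformly distributed) tends to $0$ as $n\to\infty$; the capacity region is the closure of the set of achievable rate pairs. Suppose there exist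 real numbers $R_{S_p\to S}$, $S\in\uparrow\{S_p\}$, such that $$R_p=\sum_{S\in\uparrow\{S_p\}}R_{S_p\to S},\qquad R_{S_p\to S}\ge 0\quad\text{for all } S\in\uparrow\{S_p\},$$ $$R_c+R_p\le C_{\mathsf W_j}\quad\text{for all } j\in S_p,$$ $$\sum_{S\in\mathsf B\cap\uparrow\{S_p\}}R_{S_p\to S}\le C_{\mathsf B}\quad\text{for all } j\in S_p \text{ and all down-sets } \mathsf B \text{ of } \mathsf W_j\setminus\{\{1,\dots,K\}\},$$ $$R_c+\sum_{S\in\uparrow\{S_p\cup\{i\}\}}R_{S_p\to S}\le C_{\mathsf W_i}\quad\text{for all } i\notin S_p.$$ Then for every $\delta>0$ the pair $(\max(R_p-\delta,0),\max(R_c-\delta,0))$ is achievable over the combination network; and $(R_p,R_c)$ lies in the capacity region of the combination network. -/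

import Mathlib

open Filter Topology

/-! ## Message indices and order theory (ground set ordered by inclusion) -/

/-- The family `P` of all nonempty subsets of the set of `K` receivers. -/
def indexP (K : ℕ) : Finset (Finset (Fin K)) :=
  Finset.univ.filter fun S => S.Nonempty

/-- `W_i^F`: the members of the family `F` that contain receiver `i`. -/
def idxW {K : ℕ} (F : Finset (Finset (Fin K))) (i : Fin K) : Finset (Finset (Fin K)) :=
  F.filter fun S => i ∈ S

/-- `↑_F Q`: the members of `F` that contain some member of `Q`. -/
def upSetIn {K : ℕ} (F Q : Finset (Finset (Fin K))) : Finset (Finset (Fin K)) :=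
  F.filter fun S => ∃ T ∈ Q, T ⊆ S

/-- `B` is a down-set of the family `F` ordered by inclusion. -/
def IsDownSetOf {K : ℕ} (B F : Finset (Finset (Fin K))) : Prop :=
  B ⊆ F ∧ ∀ S ∈ B, ∀ T ∈ F, T ⊆ S → T ∈ B

/-! ## Discrete memoryless broadcast channels and codes -/

/-- A discrete memoryless broadcast channel with `K` receivers: finite alphabets and a
transition probability `W (y_1, …, y_K | x)`, written `W x y`. -/
structure DMBC (K : ℕ) where
  Inp : Type
  Out : Fin K → Type
  [fintypeInp : Fintype Inp]
  [fintypeOut : ∀ k, Fintype (Out k)]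
  W : Inp → (∀ k, Out k) → ℝ
  W_nonneg : ∀ x y, 0 ≤ W x y
  W_sum : ∀ x, ∑ y, W x y = 1

attribute [instance] DMBC.fintypeInp DMBC.fintypeOut

/-- Message tuples: message `m_S`, for `S` in the message index set `E`, takes `M S` values. -/
abbrev MsgTuple {K : ℕ} (E : Finset (Finset (Fin K))) (M : E → ℕ) : Type :=
  ∀ S : E, Fin (M S)

/-- A block code of length `n`: an encoder, and for each receiver `k` a decoder that estimates
the messages `m_S` with `S ∈ E` and `k ∈ S`. -/
structure BCCode {K : ℕ} (ch : DMBC K) (E : Finset (Finset (Fin K))) (M : E → ℕ) (n : ℕ) where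
  enc : MsgTuple E M → Fin n → ch.Inp
  dec : ∀ k : Fin K, (Fin n → ch.Out k) → ∀ S : {S : E // k ∈ S.1}, Fin (M S.1)

/-- All receivers decode all their intended messages correctly. -/
def BCCode.Correct {K : ℕ} {ch : DMBC K} {E : Finset (Finset (Fin K))} {M : E → ℕ} {n : ℕ}
    (c : BCCode ch E M n) (m : MsgTuple E M) (y : Fin n → ∀ k, ch.Out k) : Prop :=
  ∀ (k : Fin K) (S : {S : E // k ∈ S.1}), c.dec k (fun t => y t k) S = m S.1

open scoped Classical in
/-- Probability that not all receivers decode correctly, for independent messages uniform on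
their ranges and `n` memoryless uses of the channel. -/
noncomputable def BCCode.errorProb {K : ℕ} {ch : DMBC K} {E : Finset (Finset (Fin K))}
    {M : E → ℕ} {n : ℕ} (c : BCCode ch E M n) : ℝ :=
  (∑ m : MsgTuple E M, ∑ y : Fin n → ∀ k, ch.Out k,
      if c.Correct m y then 0 else ∏ t, ch.W (c.enc m t) (y t))
    / (Fintype.card (MsgTuple E M) : ℝ)

/-- Number of messages of a message of rate `R` in `n` channel uses: the set `[1 : 2^{nR}]`. -/
noncomputable def numMsgs (n : ℕ) (R : ℝ) : ℕ := ⌊(2 : ℝ) ^ ((n : ℝ) * R)⌋₊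

/-- The rate tuple `(R_S : S ∈ E)` is achievable: there is a sequence of `({2^{n R_S}}, n)` codes
whose probability of error tends to `0`. -/
def Achievable {K : ℕ} (ch : DMBC K) (E : Finset (Finset (Fin K))) (R : E → ℝ) : Prop :=
  (∀ S, 0 ≤ R S) ∧
    ∃ c : ∀ n : ℕ, BCCode ch E (fun S => numMsgs n (R S)) n,
      Tendsto (fun n => (c n).errorProb) atTop (𝓝 0)

/-- The capacity region: the closure of the set of achievable rate tuples. -/
def capacityRegion {K : ℕ} (ch : DMBC K) (E : Finset (Finset (Fin K))) : Set (E → ℝ) :=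
  closure {R | Achievable ch E R}

/-! ## The combination network -/

/-- What receiver `k` sees of the input `x = (V_S : S ∈ P)`: the components `V_S` with `k ∈ S`. -/
def combOutput {K : ℕ} (v : Finset (Fin K) → ℕ) (x : ∀ S : indexP K, Fin (v S.1)) (k : Fin K) :
    ∀ S : idxW (indexP K) k, Fin (v S.1) :=
  fun S => x ⟨S.1, (Finset.mem_filter.1 S.2).1⟩

open scoped Classical in
/-- The combination network with `|𝒱_S| = v S`: the noiseless broadcast channel with
input `X = (V_S : S ∈ P)` and outputs `Y_k = (V_S : S ∈ P, k ∈ S)`. -/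
noncomputable def combinationNetwork {K : ℕ} (v : Finset (Fin K) → ℕ) : DMBC K where
  Inp := ∀ S : indexP K, Fin (v S.1)
  Out := fun k => ∀ S : idxW (indexP K) k, Fin (v S.1)
  W := fun x y => if y = combOutput v x then 1 else 0
  W_nonneg := by
    intro x y
    split_ifs <;> norm_num
  W_sum := by
    intro x
    simp

/-- Link capacity `C_S = log₂ |𝒱_S|`. -/
noncomputable def linkCap {K : ℕ} (v : Finset (Fin K) → ℕ) (S : Finset (Fin K)) : ℝ :=
  Real.logb 2 (v S)

/-- `C_B = ∑_{S ∈ B} C_S`. -/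
noncomputable def capSum {K : ℕ} (v : Finset (Fin K) → ℕ) (B : Finset (Finset (Fin K))) : ℝ :=
  ∑ S ∈ B, linkCap v S

/-! ## Two nested messages -/

/-- The message index set of two nested messages: the private message is intended for the
receivers in `Sp`, the common message for all receivers. -/
def nestedE {K : ℕ} (Sp : Finset (Fin K)) : Finset (Finset (Fin K)) := {Sp, Finset.univ}

/-- The rate tuple of the pair: rate `Rp` for the private message, `Rc` for the common one. -/
noncomputable def nestedRates {K : ℕ} (Sp : Finset (Fin K)) (Rp Rc : ℝ) : nestedE Sp → ℝ :=
  fun S => if S.1 = Sp then Rp else Rc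

/-! ## Counting random functions -/

/-! The proof is random superposition coding. The private message is split into parts indexed by the
sets `T ⊇ Sp`, part `T` having rate slightly below `r T`. Component `V_S` is a random function of
the common message and of the parts `T ⊇ S`, so receiver `k` observes no trace of a part `T` with `k
∉ T`. If receiver `k` errs, another tuple gives the same output. Let `D` be the set of coordinates
where the two differ. There are `∏ t ∈ D, (N t - 1)` such tuples, and each collides with probability
`∏ |V_S|^(-n)` over the components at `k` that depend on `D`. A union bound and averaging
(`exists_codebook`) yield one good codebook; its error vanishes if the rates in `D` sum to less than
the capacity of those components. If `D` contains the common coordinate or the part of the full set,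
all of `W_k` depends on `D`; otherwise the dependent components form a down-set of `W_k` without the
full set. A receiver outside `Sp` needs only the common message, so only sets `D` containing the
common coordinate matter. These cases are the three families of inequalities
(`sum_le_of_mem_errorSets`). -/

open Classical in
theorem card_collision_mul_le {X Y : Type*} [Fintype X] [Fintype Y] {x x' : X} (h : x ≠ x') :
    (Finset.univ.filter fun f : X → Y => f x = f x').card * Fintype.card Y
      ≤ Fintype.card (X → Y) := by
  rw [← Finset.card_univ (α := Y), ← Finset.card_product, ← Finset.card_univ (α := X → Y)]
  -- Overwriting `f x` loses nothing: on a collision `f x = f x'`, and the value at `x' ≠ x` is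
  -- untouched.
  refine Finset.card_le_card_of_injOn (fun p => Function.update p.1 x p.2)
    (fun _ _ => Finset.mem_coe.2 (Finset.mem_univ _)) ?_
  rintro ⟨f, y⟩ hf ⟨f', y'⟩ hf' heq
  simp only [Finset.coe_product, Set.mem_prod, Finset.mem_coe, Finset.mem_filter,
    Finset.mem_univ, true_and, and_true] at hf hf'
  have key : ∀ z, Function.update f x y z = Function.update f' x y' z := congrFun heq
  have hoff : ∀ z, z ≠ x → f z = f' z := fun z hz => by simpa [hz] using key z
  refine Prod.ext (funext fun z => ?_) (by simpa using key x)
  by_cases hz : z = x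
  · subst hz
    exact hf.trans ((hoff x' h.symm).trans hf'.symm)
  · exact hoff z hz

-- The functions `g s` are chosen independently, so the counts multiply: a component with equal
-- inputs always collides, one with distinct inputs in a fraction at most `1 / |Y s|` of cases.
open Classical in
theorem card_pi_collision_mul_le {ι : Type*} [Fintype ι] {X Y : ι → Type*}
    [∀ s, Fintype (X s)] [∀ s, Fintype (Y s)] (J : Finset ι) (x x' : ∀ s, X s) :
    (Finset.univ.filter fun g : ∀ s, X s → Y s => ∀ s ∈ J, g s (x s) = g s (x' s)).card
        * ∏ s ∈ J.filter (fun s => x s ≠ x' s), Fintype.card (Y s)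
      ≤ Fintype.card (∀ s, X s → Y s) := by
  have hset : (Finset.univ.filter fun g : ∀ s, X s → Y s => ∀ s ∈ J, g s (x s) = g s (x' s))
      = Fintype.piFinset fun s =>
          Finset.univ.filter fun f : X s → Y s => s ∈ J → f (x s) = f (x' s) := by
    ext g
    simp
  have hprod : ∏ s ∈ J.filter (fun s => x s ≠ x' s), Fintype.card (Y s)
      = ∏ s, if s ∈ J ∧ x s ≠ x' s then Fintype.card (Y s) else 1 := by
    rw [← Finset.prod_filter]
    refine Finset.prod_congr ?_ fun _ _ => rfl
    ext s
    simp
  rw [hset, hprod, Fintype.card_piFinset, ← Finset.prod_mul_distrib, Fintype.card_pi]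
  refine Finset.prod_le_prod' fun s _ => ?_
  by_cases hs : s ∈ J ∧ x s ≠ x' s
  · simpa only [hs, if_true, true_imp_iff, and_self, ne_eq, not_false_eq_true] using
      card_collision_mul_le hs.2
  · rw [if_neg hs, mul_one]
    exact Finset.card_le_univ _

/-- The set of coordinates in which two tuples differ. -/
noncomputable def diffSet {τ : Type*} [Fintype τ] {A : τ → Type*} (x x' : ∀ t, A t) : Finset τ :=
  open Classical in Finset.univ.filter fun t => x t ≠ x' t

theorem mem_diffSet {τ : Type*} [Fintype τ] {A : τ → Type*} {x x' : ∀ t, A t} {t : τ} :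
    t ∈ diffSet x x' ↔ x t ≠ x' t := by
  simp [diffSet]

open Classical in
theorem card_diffSet_eq {τ : Type*} [Fintype τ] {N : τ → ℕ} (x : ∀ t, Fin (N t)) (D : Finset τ) :
    (Finset.univ.filter fun x' => diffSet x x' = D).card = ∏ t ∈ D, (N t - 1) := by
  have hset : (Finset.univ.filter fun x' => diffSet x x' = D)
      = Fintype.piFinset fun t => if t ∈ D then Finset.univ.erase (x t) else {x t} := by
    ext x'
    simp only [Finset.mem_filter, Finset.mem_univ, true_and, Fintype.mem_piFinset,
      Finset.ext_iff, mem_diffSet]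
    refine forall_congr' fun t => ?_
    by_cases ht : t ∈ D <;> simp [ht, eq_comm]
  rw [hset, Fintype.card_piFinset, ← Finset.prod_subset (Finset.subset_univ D)]
  · refine Finset.prod_congr rfl fun t ht => ?_
    simp [ht]
  · intro t _ ht
    simp [ht]

/-! ## Random superposition codes -/

section Superposition

variable {τ ι κ : Type*}

/-- The coordinates of a tuple on which component `s` may depend. -/
def visPart (vis : τ → ι → Prop) {A : τ → Type*} (x : ∀ t, A t) (s : ι) :
    ∀ t : {t // vis t s}, A t.1 :=
  fun t => x t.1

/-- The components in `J` that see some coordinate of `D`. -/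
noncomputable def seenBy (vis : τ → ι → Prop) (J : Finset ι) (D : Finset τ) : Finset ι :=
  open Classical in J.filter fun s => ∃ t ∈ D, vis t s

theorem mem_seenBy {vis : τ → ι → Prop} {J : Finset ι} {D : Finset τ} {s : ι} :
    s ∈ seenBy vis J D ↔ s ∈ J ∧ ∃ t ∈ D, vis t s := by
  simp [seenBy]

theorem visPart_ne_iff [Fintype τ] {vis : τ → ι → Prop} {A : τ → Type*} {x x' : ∀ t, A t} {s : ι} :
    visPart vis x s ≠ visPart vis x' s ↔ ∃ t ∈ diffSet x x', vis t s := by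
  simp only [ne_eq, funext_iff, visPart, mem_diffSet, not_forall, Subtype.exists]
  exact exists_congr fun t => by tauto

open Classical in
/-- The number of codebooks for which tuple `x` collides, on the components in `J`, with a tuple
that differs from it in a set of coordinates belonging to `Bad`. -/
theorem card_bad_codebooks_le [Fintype τ] [Fintype ι] (vis : τ → ι → Prop) {N : τ → ℕ} {Y : ι → Type*}
    [∀ s, Fintype (Y s)] [∀ s, Nonempty (Y s)] (J : Finset ι) (Bad : Finset (Finset τ))
    (x : ∀ t, Fin (N t)) :
    ((Finset.univ.filter fun g : ∀ s, (∀ t : {t // vis t s}, Fin (N t.1)) → Y s =>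
        ∃ x', diffSet x x' ∈ Bad ∧
          ∀ s ∈ J, g s (visPart vis x s) = g s (visPart vis x' s)).card : ℝ)
      ≤ Fintype.card (∀ s, (∀ t : {t // vis t s}, Fin (N t.1)) → Y s) *
        ∑ D ∈ Bad, (∏ t ∈ D, ((N t - 1 : ℕ) : ℝ)) /
          ∏ s ∈ seenBy vis J D, (Fintype.card (Y s) : ℝ) := by
  set G := ∀ s, (∀ t : {t // vis t s}, Fin (N t.1)) → Y s
  set Coll : (∀ t, Fin (N t)) → Finset G := fun x' =>
    Finset.univ.filter fun g => ∀ s ∈ J, g s (visPart vis x s) = g s (visPart vis x' s)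
  have hsub : (Finset.univ.filter fun g : G => ∃ x', diffSet x x' ∈ Bad ∧
        ∀ s ∈ J, g s (visPart vis x s) = g s (visPart vis x' s))
      ⊆ Bad.biUnion fun D => (Finset.univ.filter fun x' => diffSet x x' = D).biUnion Coll := by
    intro g hg
    obtain ⟨x', hD, hx'⟩ := (Finset.mem_filter.1 hg).2
    exact Finset.mem_biUnion.2 ⟨_, hD, Finset.mem_biUnion.2
      ⟨x', by simp, Finset.mem_filter.2 ⟨Finset.mem_univ _, hx'⟩⟩⟩
  have hcard := (Finset.card_le_card hsub).trans (Finset.card_biUnion_le.trans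
    (Finset.sum_le_sum fun D _ => Finset.card_biUnion_le))
  refine (Nat.cast_le.2 hcard).trans ?_
  push_cast
  rw [Finset.mul_sum]
  refine Finset.sum_le_sum fun D _ => ?_
  have hpos : 0 < ∏ s ∈ seenBy vis J D, (Fintype.card (Y s) : ℝ) :=
    Finset.prod_pos fun s _ => Nat.cast_pos.2 Fintype.card_pos
  have hcoll : ∀ x' ∈ Finset.univ.filter (fun x' => diffSet x x' = D), ((Coll x').card : ℝ)
      ≤ Fintype.card G / ∏ s ∈ seenBy vis J D, (Fintype.card (Y s) : ℝ) := by
    intro x' hx'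
    rw [le_div_iff₀ hpos]
    have h := card_pi_collision_mul_le (Y := Y) J (visPart vis x) (visPart vis x')
    have hs : ∀ inst : DecidablePred fun s => visPart vis x s ≠ visPart vis x' s,
        @Finset.filter _ _ inst J = seenBy vis J D := by
      intro inst
      ext s
      rw [Finset.mem_filter, mem_seenBy, visPart_ne_iff, (Finset.mem_filter.1 hx').2]
    rw [hs] at h
    have h' : (Coll x').card * ∏ s ∈ seenBy vis J D, Fintype.card (Y s) ≤ Fintype.card G := by
      convert h
    exact_mod_cast h'
  refine (Finset.sum_le_card_nsmul _ _ _ hcoll).trans (le_of_eq ?_)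
  rw [nsmul_eq_mul, card_diffSet_eq]
  push_cast
  ring

open Classical in
/-- Some codebook has a small fraction of colliding messages. -/
theorem exists_codebook [Fintype τ] [Fintype ι] [Fintype κ] (vis : τ → ι → Prop) {N : τ → ℕ} {Y : ι → Type*}
    [∀ s, Fintype (Y s)] [∀ s, Nonempty (Y s)] (J : κ → Finset ι)
    (Bad : κ → Finset (Finset τ)) {𝓜 : Type*} [Fintype 𝓜] (e : 𝓜 → ∀ t, Fin (N t)) :
    ∃ g : ∀ s, (∀ t : {t // vis t s}, Fin (N t.1)) → Y s,
      ∀ C : Finset 𝓜, (∀ m ∈ C, ∃ k x', diffSet (e m) x' ∈ Bad k ∧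
          ∀ s ∈ J k, g s (visPart vis (e m) s) = g s (visPart vis x' s)) →
        (C.card : ℝ) ≤ Fintype.card 𝓜 * ∑ k, ∑ D ∈ Bad k, (∏ t ∈ D, ((N t - 1 : ℕ) : ℝ)) /
            ∏ s ∈ seenBy vis (J k) D, (Fintype.card (Y s) : ℝ) := by
  set G := ∀ s, (∀ t : {t // vis t s}, Fin (N t.1)) → Y s
  set ε : κ → ℝ := fun k => ∑ D ∈ Bad k, (∏ t ∈ D, ((N t - 1 : ℕ) : ℝ)) /
            ∏ s ∈ seenBy vis (J k) D, (Fintype.card (Y s) : ℝ)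
  set P : κ → 𝓜 → G → Prop := fun k m g => ∃ x', diffSet (e m) x' ∈ Bad k ∧
          ∀ s ∈ J k, g s (visPart vis (e m) s) = g s (visPart vis x' s)
  have hm : ∀ m, ((Finset.univ.filter fun g : G => ∃ k, P k m g).card : ℝ)
      ≤ Fintype.card G * ∑ k, ε k := by
    intro m
    have hsub : (Finset.univ.filter fun g : G => ∃ k, P k m g)
        ⊆ Finset.univ.biUnion fun k => Finset.univ.filter fun g : G => P k m g := by
      intro g hg
      obtain ⟨k, hk⟩ := (Finset.mem_filter.1 hg).2
      exact Finset.mem_biUnion.2 ⟨k, Finset.mem_univ _, Finset.mem_filter.2 ⟨Finset.mem_univ _, hk⟩⟩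
    refine (Nat.cast_le.2 ((Finset.card_le_card hsub).trans Finset.card_biUnion_le)).trans ?_
    push_cast
    rw [Finset.mul_sum]
    exact Finset.sum_le_sum fun k _ => card_bad_codebooks_le vis (J k) (Bad k) (e m)
  -- Double counting of bad (codebook, message) pairs turns the bound for each message into an
  -- average over codebooks.
  have hdc : ∑ g : G, ((Finset.univ.filter fun m => ∃ k, P k m g).card : ℝ)
      = ∑ m, ((Finset.univ.filter fun g : G => ∃ k, P k m g).card : ℝ) := by
    simp only [Finset.card_filter, Nat.cast_sum]
    exact Finset.sum_comm
  have hsum : ∑ g : G, ((Finset.univ.filter fun m => ∃ k, P k m g).card : ℝ)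
      ≤ ∑ _g : G, (Fintype.card 𝓜 * ∑ k, ε k : ℝ) := by
    rw [hdc]
    refine (Finset.sum_le_sum fun m _ => hm m).trans (le_of_eq ?_)
    simp only [Finset.sum_const, Finset.card_univ, nsmul_eq_mul]
    ring
  obtain ⟨g, -, hg⟩ := Finset.exists_le_of_sum_le (Finset.univ_nonempty (α := G)) hsum
  refine ⟨g, fun C hC => le_trans (Nat.cast_le.2 (Finset.card_le_card fun m hm => ?_)) hg⟩
  exact Finset.mem_filter.2 ⟨Finset.mem_univ _, hC m hm⟩

end Superposition

/-! ## Codes for the combination network -/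

open scoped Classical in
/-- Over a noiseless channel the error probability is the fraction of messages that are not
decoded correctly. -/
theorem BCCode.errorProb_of_noiseless {K : ℕ} {ch : DMBC K} {E : Finset (Finset (Fin K))}
    {M : E → ℕ} {n : ℕ} (c : BCCode ch E M n) (f : ch.Inp → ∀ k, ch.Out k)
    (hf : ∀ x, ch.W x (f x) = 1) (hf' : ∀ x y, y ≠ f x → ch.W x y = 0) :
    c.errorProb = ((Finset.univ.filter fun m : MsgTuple E M =>
      ¬ c.Correct m fun t => f (c.enc m t)).card : ℝ) / Fintype.card (MsgTuple E M) := by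
  unfold BCCode.errorProb
  congr 1
  rw [Finset.card_filter, Nat.cast_sum]
  refine Finset.sum_congr rfl fun m _ => ?_
  rw [Fintype.sum_eq_single fun t => f (c.enc m t)]
  · by_cases h : c.Correct m fun t => f (c.enc m t) <;> simp [h, hf]
  · intro y hy
    obtain ⟨t, ht⟩ := Function.ne_iff.1 hy
    split_ifs
    · rfl
    · exact Finset.prod_eq_zero (Finset.mem_univ t) (hf' _ _ ht)

open scoped Classical in
theorem errorProb_combinationNetwork {K : ℕ} {v : Finset (Fin K) → ℕ} {E : Finset (Finset (Fin K))}
    {M : E → ℕ} {n : ℕ} (c : BCCode (combinationNetwork v) E M n) :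
    c.errorProb = ((Finset.univ.filter fun m : MsgTuple E M =>
      ¬ c.Correct m fun t => combOutput v (c.enc m t)).card : ℝ) / Fintype.card (MsgTuple E M) :=
  c.errorProb_of_noiseless (combOutput v) (fun _ => if_pos rfl) fun _ _ h => if_neg h

/-- Component `S` depends on the common coordinate `none` and on the private coordinates `some T`
with `S ⊆ T`. -/
def superVis {K : ℕ} (t : Option (Finset (Fin K))) (S : indexP K) : Prop :=
  ∀ T ∈ t, S.1 ⊆ T

/-- The components seen by receiver `k`. -/
def compsAt {K : ℕ} (k : Fin K) : Finset (indexP K) :=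
  Finset.univ.filter fun S => k ∈ S.1

open Classical in
/-- The sets of coordinates in which a tuple confused with the true one by receiver `k` may differ
from it, when the receiver fails to recover its messages. -/
noncomputable def errorSets {K : ℕ} (Sp : Finset (Fin K)) (k : Fin K) :
    Finset (Finset (Option (Finset (Fin K)))) :=
  Finset.univ.filter fun D =>
    (∀ T, some T ∈ D → k ∈ T) ∧ D.Nonempty ∧ (k ∉ Sp → none ∈ D)

theorem mem_errorSets {K : ℕ} {Sp : Finset (Fin K)} {k : Fin K}
    {D : Finset (Option (Finset (Fin K)))} :
    D ∈ errorSets Sp k ↔ (∀ T, some T ∈ D → k ∈ T) ∧ D.Nonempty ∧ (k ∉ Sp → none ∈ D) := by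
  simp [errorSets]

theorem mem_nestedE {K : ℕ} {Sp S : Finset (Fin K)} :
    S ∈ nestedE Sp ↔ S = Sp ∨ S = Finset.univ := by
  simp [nestedE]

/-- Decoding to any message consistent with the channel output: when this fails, some receiver
cannot tell the message that was sent from one that differs in an intended component. -/
theorem exists_code_of_encoder {K : ℕ} {v : Finset (Fin K) → ℕ} {E : Finset (Finset (Fin K))}
    {M : E → ℕ} (hM : ∀ S, 0 < M S) {n : ℕ}
    (enc : MsgTuple E M → Fin n → ∀ S : indexP K, Fin (v S.1)) :
    ∃ c : BCCode (combinationNetwork v) E M n, c.enc = enc ∧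
      ∀ m, ¬ c.Correct m (fun t => combOutput v (enc m t)) →
        ∃ (k : Fin K) (S : E) (m' : MsgTuple E M), k ∈ S.1 ∧ m' S ≠ m S ∧
          ∀ s : indexP K, k ∈ s.1 → ∀ i, enc m i s = enc m' i s := by
  classical
  -- The default message `0` is never used on actual outputs, since the transmitted message is
  -- consistent with them.
  refine ⟨⟨enc, fun k y S => if h : ∃ m, ∀ i, y i = combOutput v (enc m i) k
    then h.choose S.1 else ⟨0, hM S.1⟩⟩, rfl, fun m hm => ?_⟩
  simp only [BCCode.Correct, not_forall] at hm
  obtain ⟨k, S, hS⟩ := hm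
  have hex : ∃ m', ∀ i, combOutput v (enc m i) k = combOutput v (enc m' i) k := ⟨m, fun _ => rfl⟩
  replace hS : ¬ hex.choose S.1 = m S.1 := fun h => hS ((dif_pos hex).trans h)
  exact ⟨k, S.1, hex.choose, S.2, hS, fun s hs i =>
    congrFun (hex.choose_spec i) ⟨s.1, Finset.mem_filter.2 ⟨s.2, hs⟩⟩⟩

/-- A decoding failure at `k` produces a collision whose difference set lies in `errorSets Sp k`, so
the error is bounded by the fraction of colliding messages. Hypothesis `hc` says that the common
coordinate determines the common message. -/
theorem exists_superposition_code {K : ℕ} {v : Finset (Fin K) → ℕ} (hv : ∀ S ∈ indexP K, 0 < v S)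
    (Sp : Finset (Fin K)) (M : nestedE Sp → ℕ) (hM : ∀ S, 0 < M S) (n : ℕ)
    (N : Option (Finset (Fin K)) → ℕ) (hN : ∀ T, ¬ Sp ⊆ T → N (some T) = 1)
    (e : MsgTuple (nestedE Sp) M → ∀ t, Fin (N t)) (he : Function.Injective e)
    (hc : ∀ m m', e m none = e m' none → ∀ S : nestedE Sp, S.1 = Finset.univ → m S = m' S) :
    ∃ c : BCCode (combinationNetwork v) (nestedE Sp) M n,
      c.errorProb ≤ ∑ k, ∑ D ∈ errorSets Sp k, (∏ t ∈ D, ((N t - 1 : ℕ) : ℝ)) /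
        ∏ S ∈ seenBy superVis (compsAt k) D, (v S.1 : ℝ) ^ n := by
  classical
  have : ∀ S : indexP K, Nonempty (Fin n → Fin (v S.1)) := fun S =>
    ⟨fun _ => ⟨0, hv S.1 S.2⟩⟩
  obtain ⟨g, hg⟩ := exists_codebook (Y := fun S : indexP K => Fin n → Fin (v S.1))
    superVis compsAt (errorSets Sp) e
  obtain ⟨c, hcenc, hcorrect⟩ := exists_code_of_encoder (v := v) hM (n := n)
    fun m i S => g S (visPart superVis (e m) S) i
  refine ⟨c, ?_⟩
  rw [errorProb_combinationNetwork, hcenc]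
  have hcardM : (0 : ℝ) < Fintype.card (MsgTuple (nestedE Sp) M) := by
    have : Nonempty (MsgTuple (nestedE Sp) M) := ⟨fun S => ⟨0, hM S⟩⟩
    exact Nat.cast_pos.2 Fintype.card_pos
  rw [div_le_iff₀' hcardM]
  simp only [Fintype.card_fun, Fintype.card_fin, Nat.cast_pow] at hg
  refine hg _ fun m hm => ?_
  obtain ⟨k, S, m', hkS, hne, hagree⟩ := hcorrect m (Finset.mem_filter.1 hm).2
  have hsame : ∀ s ∈ compsAt k,
      g s (visPart superVis (e m) s) = g s (visPart superVis (e m') s) := fun s hs =>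
    funext (hagree s (Finset.mem_filter.1 hs).2)
  -- Coordinates `T` with `k ∉ T` are reset to their true values. No component at `k` depends on
  -- them, so the collision persists.
  let x' : ∀ t, Fin (N t) := fun t => if ∀ T ∈ t, k ∈ T then e m' t else e m t
  refine ⟨k, x', mem_errorSets.2 ⟨?_, ?_, ?_⟩, ?_⟩
  · intro T hT
    by_contra hk
    exact mem_diffSet.1 hT (by simp [x', hk])
  · by_contra hD
    rw [Finset.not_nonempty_iff_eq_empty, Finset.eq_empty_iff_forall_notMem] at hD
    simp only [mem_diffSet, not_not] at hD
    have hnone : e m none = e m' none := by simpa [x'] using hD none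
    have hSp : S.1 = Sp := by
      exact (mem_nestedE.1 S.2).resolve_right fun h => hne (hc _ _ hnone _ h).symm
    have hk : k ∈ Sp := hSp ▸ hkS
    refine hne (congrFun (he (funext fun t => ?_)) S).symm
    rcases t with _ | T
    · exact hnone
    · by_cases hkT : k ∈ T
      · simpa [x', hkT] using hD (some T)
      · have h1 := hN T fun h => hkT (h hk)
        have : Subsingleton (Fin (N (some T))) := by rw [h1]; infer_instance
        exact Subsingleton.elim _ _
  · intro hk
    have hSu : S.1 = Finset.univ := by
      exact (mem_nestedE.1 S.2).resolve_left fun h => hk (h ▸ hkS)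
    refine mem_diffSet.2 fun h => hne (hc _ _ ?_ _ hSu).symm
    simpa [x'] using h
  · intro s hs
    rw [hsame s hs]
    congr 1
    funext t
    have ht : ∀ T ∈ t.1, k ∈ T := fun T hT => t.2 T hT (Finset.mem_filter.1 hs).2
    simp only [visPart, x']
    rw [if_pos ht]

/-! ## Asymptotics -/

theorem two_rpow_mul_logb {q : ℕ} (hq : 0 < q) (n : ℕ) :
    (2 : ℝ) ^ ((n : ℝ) * Real.logb 2 q) = (q : ℝ) ^ n := by
  rw [mul_comm, Real.rpow_mul (by norm_num), Real.rpow_logb (by norm_num) (by norm_num)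
    (Nat.cast_pos.2 hq), Real.rpow_natCast]

/-- The quotient is at most `(2 ^ (a - b)) ^ n`, with `a` the total rate and `b` the total capacity.
In the other case a coordinate of rate `0` has one value and can never differ: its factor `⌈1⌉ - 1`
is zero. -/
theorem tendsto_collision_bound {τ ι : Type*} (D : Finset τ) (A : Finset ι) (ρ : τ → ℝ)
    (q : ι → ℕ) (hq : ∀ s, 0 < q s)
    (h : (∃ t ∈ D, ρ t = 0) ∨ ∑ t ∈ D, ρ t < ∑ s ∈ A, Real.logb 2 (q s)) :
    Tendsto (fun n : ℕ => (∏ t ∈ D, ((⌈(2 : ℝ) ^ ((n : ℝ) * ρ t)⌉₊ - 1 : ℕ) : ℝ)) /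
      ∏ s ∈ A, (q s : ℝ) ^ n) atTop (𝓝 0) := by
  rcases h with ⟨t, ht, h0⟩ | h
  · refine tendsto_const_nhds.congr fun n => ?_
    rw [Finset.prod_eq_zero ht (by simp [h0]), zero_div]
  set a := ∑ t ∈ D, ρ t
  set b := ∑ s ∈ A, Real.logb 2 (q s)
  have hlim : Tendsto (fun n : ℕ => ((2 : ℝ) ^ (a - b)) ^ n) atTop (𝓝 0) :=
    tendsto_pow_atTop_nhds_zero_of_lt_one (by positivity)
      (Real.rpow_lt_one_of_one_lt_of_neg (by norm_num) (by linarith))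
  refine squeeze_zero (fun n => by positivity) (fun n => ?_) hlim
  have hden : ∏ s ∈ A, (q s : ℝ) ^ n = (2 : ℝ) ^ ((n : ℝ) * b) := by
    rw [Finset.mul_sum, Real.rpow_sum_of_pos (by norm_num)]
    exact Finset.prod_congr rfl fun s _ => (two_rpow_mul_logb (hq s) n).symm
  have hnum : ∏ t ∈ D, ((⌈(2 : ℝ) ^ ((n : ℝ) * ρ t)⌉₊ - 1 : ℕ) : ℝ) ≤ (2 : ℝ) ^ ((n : ℝ) * a) := by
    rw [Finset.mul_sum, Real.rpow_sum_of_pos (by norm_num)]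
    refine Finset.prod_le_prod (fun _ _ => by positivity) fun t _ => ?_
    have hpos : (0 : ℝ) < (2 : ℝ) ^ ((n : ℝ) * ρ t) := by positivity
    rw [Nat.cast_sub (Nat.one_le_iff_ne_zero.2 (Nat.ceil_pos.2 hpos).ne')]
    have := Nat.ceil_lt_add_one hpos.le
    push_cast
    linarith
  rw [hden, ← Real.rpow_natCast, ← Real.rpow_mul (by norm_num), mul_comm (a - b), mul_sub,
    Real.rpow_sub (by norm_num)]
  gcongr

theorem numMsgs_pos {n : ℕ} {R : ℝ} (hR : 0 ≤ R) : 0 < numMsgs n R :=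
  Nat.floor_pos.2 (Real.one_le_rpow (by norm_num) (by positivity))

/-- This makes room for an injection of the private messages into tuples of parts. Rounding part
sizes up ensures it, and still gives size one at rate `0`. -/
theorem numMsgs_le_prod {τ : Type*} [Fintype τ] (n : ℕ) (ρ : τ → ℝ) :
    numMsgs n (∑ t, ρ t) ≤ ∏ t, ⌈(2 : ℝ) ^ ((n : ℝ) * ρ t)⌉₊ := by
  refine Nat.floor_le_of_le ?_
  rw [Finset.mul_sum, Real.rpow_sum_of_pos (by norm_num)]
  push_cast
  exact Finset.prod_le_prod (fun _ _ => by positivity) fun t _ => Nat.le_ceil _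

/-- Superposition coding: the private message is split into parts of rates `ρ (some T)`. -/
theorem achievable_of_split {K : ℕ} {v : Finset (Fin K) → ℕ} (hv : ∀ S ∈ indexP K, 0 < v S)
    {Sp : Finset (Fin K)} (hSl : Sp ≠ Finset.univ) (ρ : Option (Finset (Fin K)) → ℝ)
    (hρ : ∀ t, 0 ≤ ρ t) (hsupp : ∀ T, ¬ Sp ⊆ T → ρ (some T) = 0)
    (hrate : ∀ k, ∀ D ∈ errorSets Sp k, (∃ t ∈ D, ρ t = 0) ∨
      ∑ t ∈ D, ρ t < ∑ S ∈ seenBy superVis (compsAt k) D, linkCap v S.1) :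
    Achievable (combinationNetwork v) (nestedE Sp)
      (nestedRates Sp (∑ T, ρ (some T)) (ρ none)) := by
  classical
  have hR : ∀ S, 0 ≤ nestedRates Sp (∑ T, ρ (some T)) (ρ none) S := by
    intro S
    unfold nestedRates
    split_ifs
    exacts [Finset.sum_nonneg fun T _ => hρ _, hρ _]
  refine ⟨hR, ?_⟩
  let sP : nestedE Sp := ⟨Sp, by simp [nestedE]⟩
  let sC : nestedE Sp := ⟨Finset.univ, by simp [nestedE]⟩
  let R := nestedRates Sp (∑ T, ρ (some T)) (ρ none)
  have hRP : R sP = ∑ T, ρ (some T) := if_pos rfl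
  have hRC : R sC = ρ none := if_neg hSl.symm
  have hcode : ∀ n : ℕ, ∃ c : BCCode (combinationNetwork v) (nestedE Sp)
      (fun S => numMsgs n (R S)) n,
      c.errorProb ≤ ∑ k, ∑ D ∈ errorSets Sp k,
        (∏ t ∈ D, ((⌈(2 : ℝ) ^ ((n : ℝ) * ρ t)⌉₊ - 1 : ℕ) : ℝ)) /
        ∏ S ∈ seenBy superVis (compsAt k) D, (v S.1 : ℝ) ^ n := by
    intro n
    obtain ⟨eP⟩ : Nonempty (Fin (numMsgs n (R sP)) ↪
        ∀ T : Finset (Fin K), Fin ⌈(2 : ℝ) ^ ((n : ℝ) * ρ (some T))⌉₊) := by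
      rw [Function.Embedding.nonempty_iff_card_le, Fintype.card_pi, hRP]
      simpa using numMsgs_le_prod n fun T => ρ (some T)
    obtain ⟨eC⟩ : Nonempty (Fin (numMsgs n (R sC)) ↪ Fin ⌈(2 : ℝ) ^ ((n : ℝ) * ρ none)⌉₊) := by
      rw [Function.Embedding.nonempty_iff_card_le, hRC, Fintype.card_fin, Fintype.card_fin]
      exact Nat.floor_le_ceil _
    let e : MsgTuple (nestedE Sp) (fun S => numMsgs n (R S)) →
        ∀ t, Fin ⌈(2 : ℝ) ^ ((n : ℝ) * ρ t)⌉₊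
      | m, none => eC (m sC)
      | m, some T => eP (m sP) T
    have hC : ∀ m m', e m none = e m' none → ∀ S : nestedE Sp, S.1 = Finset.univ →
        m S = m' S := by
      intro m m' h S hS
      obtain rfl : S = sC := Subtype.ext hS
      exact eC.injective h
    refine exists_superposition_code hv Sp _ (fun S => numMsgs_pos (hR S)) n _ (fun T hT => ?_) e
      (fun m m' h => funext fun S => ?_) hC
    · simp [hsupp T hT]
    · rcases mem_nestedE.1 S.2 with hS | hS
      · obtain rfl : S = sP := Subtype.ext hS
        exact eP.injective (funext fun T => congrFun h (some T))
      · exact hC m m' (congrFun h none) S hS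
  choose c hc using hcode
  refine ⟨c, squeeze_zero (fun n => ?_) hc ?_⟩
  · rw [errorProb_combinationNetwork]
    positivity
  · have h0 : (0 : ℝ) = ∑ k : Fin K, ∑ D ∈ errorSets Sp k, 0 := by simp
    rw [h0]
    exact tendsto_finsetSum _ fun k _ => tendsto_finsetSum _ fun D hD =>
      tendsto_collision_bound D _ ρ (fun S : indexP K => v S.1) (fun S => hv S.1 S.2)
        (hrate k D hD)

/-! ## Rate splitting -/

theorem mem_upSetIn_singleton {K : ℕ} {Q : Finset (Fin K)} (hQ : Q.Nonempty)
    {S : Finset (Fin K)} : S ∈ upSetIn (indexP K) {Q} ↔ Q ⊆ S := by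
  simp only [upSetIn, indexP, Finset.mem_filter, Finset.mem_univ, true_and, Finset.mem_singleton,
    exists_eq_left, and_iff_right_iff_imp]
  exact hQ.mono

/-- The members of `W_k` that depend on some coordinate of `D`. -/
noncomputable def seenSets {K : ℕ} (k : Fin K) (D : Finset (Option (Finset (Fin K)))) :
    Finset (Finset (Fin K)) :=
  open Classical in (idxW (indexP K) k).filter fun S => ∃ t ∈ D, ∀ T ∈ t, S ⊆ T

theorem mem_seenSets {K : ℕ} {k : Fin K} {D : Finset (Option (Finset (Fin K)))}
    {S : Finset (Fin K)} :
    S ∈ seenSets k D ↔ k ∈ S ∧ ∃ t ∈ D, ∀ T ∈ t, S ⊆ T := by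
  simp only [seenSets, idxW, indexP, Finset.mem_filter, Finset.mem_univ, true_and]
  exact ⟨fun h => ⟨h.1.2, h.2⟩, fun h => ⟨⟨⟨k, h.1⟩, h.1⟩, h.2⟩⟩

theorem sum_seenBy_linkCap {K : ℕ} (v : Finset (Fin K) → ℕ) (k : Fin K)
    (D : Finset (Option (Finset (Fin K)))) :
    ∑ S ∈ seenBy superVis (compsAt k) D, linkCap v S.1 = capSum v (seenSets k D) := by
  classical
  have h : (seenBy superVis (compsAt k) D).map (Function.Embedding.subtype _) = seenSets k D := by
    ext S
    simp only [Finset.mem_map, mem_seenBy, mem_seenSets, compsAt, Finset.mem_filter,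
      Finset.mem_univ, true_and, Function.Embedding.subtype_apply, superVis]
    constructor
    · rintro ⟨S, hS, rfl⟩
      exact hS
    · intro hS
      exact ⟨⟨S, Finset.mem_filter.2 ⟨Finset.mem_univ _, ⟨k, hS.1⟩⟩⟩, hS, rfl⟩
  rw [capSum, ← h, Finset.sum_map]
  rfl

theorem seenSets_eq_idxW {K : ℕ} {k : Fin K} {D : Finset (Option (Finset (Fin K)))}
    (h : none ∈ D ∨ some Finset.univ ∈ D) : seenSets k D = idxW (indexP K) k := by
  ext S
  rw [mem_seenSets, idxW, indexP, Finset.mem_filter, Finset.mem_filter]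
  refine ⟨fun hS => ⟨⟨Finset.mem_univ _, k, hS.1⟩, hS.1⟩, fun hS => ⟨hS.2, ?_⟩⟩
  rcases h with h | h
  · exact ⟨none, h, by simp⟩
  · exact ⟨some Finset.univ, h, by simp⟩

/-- A component is seen when it lies below some changed part, a condition inherited by subsets; the
full set lies only below itself. -/
theorem isDownSetOf_seenSets {K : ℕ} {k : Fin K} {D : Finset (Option (Finset (Fin K)))}
    (hn : none ∉ D) (hu : some Finset.univ ∉ D) :
    IsDownSetOf (seenSets k D) ((idxW (indexP K) k).erase Finset.univ) := by
  refine ⟨fun S hS => ?_, fun S hS T hT hTS => ?_⟩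
  · refine Finset.mem_erase.2 ⟨?_, (Finset.mem_filter.1 hS).1⟩
    rintro rfl
    obtain ⟨-, t, ht, hsub⟩ := mem_seenSets.1 hS
    rcases t with _ | T
    · exact hn ht
    · exact hu (Finset.univ_subset_iff.1 (hsub T rfl) ▸ ht)
  · obtain ⟨-, t, ht, hsub⟩ := mem_seenSets.1 hS
    exact mem_seenSets.2 ⟨(Finset.mem_filter.1 (Finset.mem_erase.1 hT).2).2, t, ht,
      fun U hU => hTS.trans (hsub U hU)⟩

/-- A set of coordinates of nonnegative rate, whose private members lie in `A`, has total rate at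
most the common rate plus that of `A`. -/
theorem sum_option_le {α : Type*} {D : Finset (Option α)} {A : Finset α} {ρ : Option α → ℝ}
    {c : ℝ} (hc : 0 ≤ c) (hnone : none ∈ D → ρ none ≤ c) (hA : ∀ a ∈ A, 0 ≤ ρ (some a))
    (hD : ∀ a, some a ∈ D → a ∈ A) : ∑ t ∈ D, ρ t ≤ c + ∑ a ∈ A, ρ (some a) := by
  classical
  have hsome : ∑ a ∈ D.eraseNone, ρ (some a) ≤ ∑ a ∈ A, ρ (some a) :=
    Finset.sum_le_sum_of_subset_of_nonneg (fun a ha => hD a (Finset.mem_eraseNone.1 ha))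
      fun a ha _ => hA a ha
  have herase : ∑ a ∈ D.eraseNone, ρ (some a) = ∑ t ∈ D.erase none, ρ t := by
    rw [← Finset.map_some_eraseNone, Finset.sum_map]
    rfl
  by_cases h : none ∈ D
  · rw [← Finset.add_sum_erase D ρ h, ← herase]
    exact add_le_add (hnone h) hsome
  · rw [Finset.erase_eq_of_notMem h] at herase
    linarith

/-- The hypotheses of the rate-splitting bound control every possible error set. -/
theorem sum_le_of_mem_errorSets {K : ℕ} {v : Finset (Fin K) → ℕ} {Sp : Finset (Fin K)}
    (hSp : Sp.Nonempty) {Rp Rc : ℝ} (hRc : 0 ≤ Rc) {r : Finset (Fin K) → ℝ}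
    (hRp : Rp = ∑ S ∈ upSetIn (indexP K) {Sp}, r S)
    (hr : ∀ S ∈ upSetIn (indexP K) {Sp}, 0 ≤ r S)
    (hfull : ∀ j ∈ Sp, Rc + Rp ≤ capSum v (idxW (indexP K) j))
    (hdown : ∀ j ∈ Sp, ∀ B, IsDownSetOf B ((idxW (indexP K) j).erase Finset.univ) →
      ∑ S ∈ B ∩ upSetIn (indexP K) {Sp}, r S ≤ capSum v B)
    (hout : ∀ i, i ∉ Sp →
      Rc + ∑ S ∈ upSetIn (indexP K) {insert i Sp}, r S ≤ capSum v (idxW (indexP K) i))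
    (k : Fin K) {D : Finset (Option (Finset (Fin K)))} (hD : D ∈ errorSets Sp k)
    (hDup : ∀ T, some T ∈ D → Sp ⊆ T) :
    ∑ t ∈ D, t.elim Rc r ≤ capSum v (seenSets k D) := by
  obtain ⟨hkD, -, hnone⟩ := mem_errorSets.1 hD
  have hmem : ∀ {S}, S ∈ upSetIn (indexP K) {Sp} ↔ Sp ⊆ S := mem_upSetIn_singleton hSp
  by_cases hk : k ∈ Sp
  · by_cases h : none ∈ D ∨ some Finset.univ ∈ D
    · rw [seenSets_eq_idxW h]
      refine le_trans ?_ (hfull k hk)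
      rw [hRp]
      exact sum_option_le hRc (fun _ => le_rfl) hr fun T hT => hmem.2 (hDup T hT)
    · obtain ⟨hn, hu⟩ := not_or.1 h
      refine le_trans ?_ (hdown k hk _ (isDownSetOf_seenSets hn hu))
      -- The common rate is absent here. Each changed part `T` is in the down-set because component
      -- `T` depends on part `T`.
      rw [← zero_add (∑ S ∈ _, r S)]
      exact sum_option_le le_rfl (fun h => absurd h hn)
        (fun S hS => hr S (Finset.mem_inter.1 hS).2) fun T hT => Finset.mem_inter.2
          ⟨mem_seenSets.2 ⟨hkD T hT, some T, hT, by simp⟩, hmem.2 (hDup T hT)⟩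
  · rw [seenSets_eq_idxW (Or.inl (hnone hk))]
    have hmem' : ∀ {S}, S ∈ upSetIn (indexP K) {insert k Sp} ↔ insert k Sp ⊆ S :=
      mem_upSetIn_singleton (Finset.insert_nonempty k Sp)
    refine le_trans ?_ (hout k hk)
    exact sum_option_le hRc (fun _ => le_rfl)
      (fun S hS => hr S (hmem.2 ((Finset.subset_insert k Sp).trans (hmem'.1 hS))))
      fun T hT => hmem'.2 (Finset.insert_subset (hkD T hT) (hDup T hT))

theorem max_sub_zero_lt {a δ : ℝ} (hδ : 0 < δ) (h : max (a - δ) 0 ≠ 0) : max (a - δ) 0 < a := by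
  rcases max_choice (a - δ) 0 with h' | h'
  · rw [h']
    linarith
  · exact absurd h' h

theorem mainTheorem9 (K : ℕ) (v : Finset (Fin K) → ℕ) (hv : ∀ S ∈ indexP K, 0 < v S)
    (Sp : Finset (Fin K)) (hSp : Sp.Nonempty) (hSl : Sp ≠ Finset.univ)
    (Rp Rc : ℝ) (hRc : 0 ≤ Rc)
    (hsplit : ∃ r : Finset (Fin K) → ℝ,
      Rp = ∑ S ∈ upSetIn (indexP K) {Sp}, r S ∧
      (∀ S ∈ upSetIn (indexP K) {Sp}, 0 ≤ r S) ∧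
      (∀ j ∈ Sp, Rc + Rp ≤ capSum v (idxW (indexP K) j)) ∧
      (∀ j ∈ Sp, ∀ B, IsDownSetOf B ((idxW (indexP K) j).erase Finset.univ) →
        ∑ S ∈ B ∩ upSetIn (indexP K) {Sp}, r S ≤ capSum v B) ∧
      (∀ i, i ∉ Sp →
        Rc + ∑ S ∈ upSetIn (indexP K) {insert i Sp}, r S ≤ capSum v (idxW (indexP K) i))) :
    (∀ δ : ℝ, 0 < δ →
      Achievable (combinationNetwork v) (nestedE Sp)
        (nestedRates Sp (max (Rp - δ) 0) (max (Rc - δ) 0))) ∧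
    nestedRates Sp Rp Rc ∈ capacityRegion (combinationNetwork v) (nestedE Sp) := by
  classical
  obtain ⟨r, hRp, hr, hfull, hdown, hout⟩ := hsplit
  have hmem : ∀ {S}, S ∈ upSetIn (indexP K) {Sp} ↔ Sp ⊆ S := mem_upSetIn_singleton hSp
  have hRp0 : 0 ≤ Rp := hRp ▸ Finset.sum_nonneg hr
  have hach : ∀ δ : ℝ, 0 < δ → Achievable (combinationNetwork v) (nestedE Sp)
      (nestedRates Sp (max (Rp - δ) 0) (max (Rc - δ) 0)) := by
    intro δ hδ
    -- All parts are scaled by one factor so that they sum to the reduced private rate. If `Rp = 0`,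
    -- division by zero gives `a = 0`, so `a < 1` still holds.
    set a := max (Rp - δ) 0 / Rp with ha
    have ha0 : 0 ≤ a := div_nonneg (le_max_right _ _) hRp0
    have haRp : a * Rp = max (Rp - δ) 0 := by
      rcases hRp0.eq_or_lt with h | h
      · rw [← h, mul_zero, max_eq_right (by linarith)]
      · exact div_mul_cancel₀ _ h.ne'
    have ha1 : a < 1 := by
      rcases hRp0.eq_or_lt with h | h
      · rw [ha, ← h, div_zero]
        exact one_pos
      · rw [ha, div_lt_one h]
        exact max_lt (by linarith) h
    let ρ : Option (Finset (Fin K)) → ℝ := fun t =>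
      t.elim (max (Rc - δ) 0) fun T => if Sp ⊆ T then a * r T else 0
    have hsum : ∑ T, ρ (some T) = max (Rp - δ) 0 := by
      rw [← haRp, hRp, Finset.mul_sum]
      refine (Finset.sum_filter _ _).symm.trans (Finset.sum_congr ?_ fun _ _ => rfl)
      ext S
      rw [hmem]
      simp
    have hρ0 : ∀ t, 0 ≤ ρ t := by
      rintro (_ | T)
      · exact le_max_right _ _
      · by_cases hT : Sp ⊆ T
        · simpa [ρ, hT] using mul_nonneg ha0 (hr T (hmem.2 hT))
        · simp [ρ, hT]
    have hmain := achievable_of_split hv hSl ρ hρ0 (fun T hT => if_neg hT) ?_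
    · rwa [hsum] at hmain
    · intro k D hD
      -- If no rate in `D` is zero, every one is strictly below its original value; as `D` is
      -- nonempty, the weak inequality for the original rates becomes strict.
      refine or_iff_not_imp_left.2 fun hne => ?_
      have hne' : ∀ t ∈ D, ρ t ≠ 0 := fun t ht h => hne ⟨t, ht, h⟩
      have hDup : ∀ T, some T ∈ D → Sp ⊆ T := fun T hT => by
        by_contra h
        exact hne' _ hT (if_neg h)
      rw [sum_seenBy_linkCap]
      refine lt_of_lt_of_le (Finset.sum_lt_sum_of_nonempty (mem_errorSets.1 hD).2.1 ?_)
        (sum_le_of_mem_errorSets hSp hRc hRp hr hfull hdown hout k hD hDup)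
      rintro (_ | T) ht
      · exact max_sub_zero_lt hδ (hne' _ ht)
      · have hT := hDup T ht
        have hρT : ρ (some T) = a * r T := if_pos hT
        have hrT : 0 < r T := (hr T (hmem.2 hT)).lt_of_ne' fun h =>
          hne' _ ht (by rw [hρT, h, mul_zero])
        rw [hρT]
        exact mul_lt_of_lt_one_left hrT ha1
  refine ⟨hach, ?_⟩
  have hlim : Tendsto (fun δ : ℝ => nestedRates Sp (max (Rp - δ) 0) (max (Rc - δ) 0)) (𝓝[>] 0)
      (𝓝 (nestedRates Sp Rp Rc)) := by
    have hone : ∀ R : ℝ, 0 ≤ R → Tendsto (fun δ : ℝ => max (R - δ) 0) (𝓝[>] 0) (𝓝 R) := by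
      intro R hR
      have hcont : Continuous fun δ : ℝ => max (R - δ) 0 := by fun_prop
      have h := (hcont.tendsto 0).mono_left (nhdsWithin_le_nhds (s := Set.Ioi 0))
      rwa [sub_zero, max_eq_left hR] at h
    refine tendsto_pi_nhds.2 fun S => ?_
    by_cases hS : S.1 = Sp
    · simpa only [nestedRates, if_pos hS] using hone Rp hRp0
    · simpa only [nestedRates, if_neg hS] using hone Rc hRc
  exact mem_closure_of_tendsto hlim (eventually_mem_nhdsWithin.mono fun δ hδ => hach δ hδ)
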